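/- Let $R$ be a commutative Noetherian ring with identity, let $t \ge 0$ and let $I_1,\ldots,I_t$ be ideals of $R$. Let $M$ and $N$ be finitely generated $R$-modules and let $N' \subseteq N$ be a submodule. For $\mathbf{n} = (n_1,\ldots,n_t) \in \mathbb{N}^t$ (where $0 \in \mathbb{N}$) write $\mathbf{I}^{\mathbf{n}} := I_1^{n_1}\cdots I_t^{n_t}$, and order $\mathbb{N}^t$ componentwise. Fix an integer $i \ge 0$. Then there exists $\mathbf{k} \in \mathbb{N}^t$ such that the sets of associated primes $$\operatorname{Ass}_R\bigl(\operatorname{Ext}^i_R(M, N/\mathbf{I}^{\mathbf{n}} N')\bigr) \quad\text{and}\quad \operatorname{Ass}_R\bigl(\operatorname{Tor}_i^R(M, N/\mathbf{I}^{\mathbf{n}} N')\bigr)$$ are independent of $\mathbf{n}$ for all $\mathbf{n} \ge \mathbf{k}$; that is, for all $\mathbf{m},\mathbf{n} \ge \mathbf{k}$ the first sets for $\mathbf{m}$ and $\mathbf{n}$ coincide, and so do the second. -/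

import Mathlib

universe u

open CategoryTheory

/-- The quotient `N / I₁^{n₁} ⋯ I_t^{n_t} N'`, for ideals `I₁, …, I_t` of `R`, a submodule `N'`
of `N` and `n ∈ ℕ^t`. -/
abbrev powQuot {R : Type u} [CommRing R] {t : ℕ} (I : Fin t → Ideal R)
    {N : Type u} [AddCommGroup N] [Module R N] (N' : Submodule R N) (n : Fin t → ℕ) : Type u :=
  N ⧸ ((∏ j, I j ^ n j) • N')

/-- The `R`-module `Ext^i_R(M, N / I₁^{n₁} ⋯ I_t^{n_t} N')`. -/
abbrev extQuot {R : Type u} [CommRing R] {t : ℕ} (I : Fin t → Ideal R)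
    (M : Type u) [AddCommGroup M] [Module R M] {N : Type u} [AddCommGroup N] [Module R N]
    (N' : Submodule R N) (i : ℕ) (n : Fin t → ℕ) : Type u :=
  Abelian.Ext (ModuleCat.of R M) (ModuleCat.of R (powQuot I N' n)) i

/-- The `R`-module `Tor_i^R(M, N / I₁^{n₁} ⋯ I_t^{n_t} N')`: the value at `M` of the `i`-th left
derived functor of `- ⊗_R (N / I₁^{n₁} ⋯ I_t^{n_t} N')`. -/
noncomputable abbrev torQuot {R : Type u} [CommRing R] {t : ℕ} (I : Fin t → Ideal R)
    (M : Type u) [AddCommGroup M] [Module R M] {N : Type u} [AddCommGroup N] [Module R N]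
    (N' : Submodule R N) (i : ℕ) (n : Fin t → ℕ) : ModuleCat.{u} R :=
  ((Tor' (ModuleCat.{u} R) i).obj (ModuleCat.of R M)).obj (ModuleCat.of R (powQuot I N' n))

/-! Take a resolution F of M by finite free modules. Each term of Hom(F, N/IⁿN') is a quotient of
Hom(F_j, N) by Iⁿ times the maps into N', and likewise for F ⊗ N/IⁿN'. So both families are
homologies of A → B/IⁿB' → C/IⁿC' for fixed maps f : A → B, g : B → C with gf = 0, presented as
g⁻¹(IⁿC') / (im f + IⁿB'). Dividing by im f leaves Zₙ/IⁿE, with Zₙ = g⁻¹(IⁿC') inside a fixed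
finitely generated module V.

Only finitely many primes matter: all of them have the form (IⁿE : x) with x in V, and filtering V ⊇
E ⊇ … by raising one exponent at a time reduces this to the layers IⁿE/I^(n+e_j)E. For fixed j these
are controlled by one finitely generated module over the Noetherian multi-Rees algebra
(`finite_setOf_isPrimeColon_multiPow_smul`).

It remains to treat a single prime p (`exists_forall_ge_isPrimeColon_iff`). It is associated exactly
when Lₙ = {x ∈ Zₙ : px ⊆ IⁿE} is not contained in IⁿE after localizing at p. As Lₙ is the preimage
of IⁿG under one linear map Φ, Artin–Rees gives L_(m+l) = ker Φ + IᵐL_l. Containment of ker Φ, once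
false, stays false as n grows; if ker Φ is always contained, containment of IᵐL_l, once true, stays
true. Either way the answer is eventually constant. -/

/-! ### The multi-Rees algebra, Artin–Rees for several ideals, and finiteness of primes. -/

section MultiRees

open MvPolynomial

variable {R : Type*} [CommRing R] {σ : Type*} [Fintype σ]

/-- The product `∏ j, I j ^ n j` of powers of a finite family of ideals. -/
def multiPow (I : σ → Ideal R) (n : σ →₀ ℕ) : Ideal R := ∏ j, I j ^ n j

lemma multiPow_zero (I : σ → Ideal R) : multiPow I 0 = 1 := by simp [multiPow]

lemma multiPow_add (I : σ → Ideal R) (m n : σ →₀ ℕ) :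
    multiPow I (m + n) = multiPow I m * multiPow I n := by
  simp [multiPow, pow_add, Finset.prod_mul_distrib]

lemma multiPow_antitone (I : σ → Ideal R) : Antitone (multiPow I) := by
  intro m n h
  obtain ⟨d, rfl⟩ := exists_add_of_le h
  rw [multiPow_add]
  exact Ideal.mul_le_left (I := multiPow I m)

lemma multiPow_single (I : σ → Ideal R) (j : σ) : multiPow I (Finsupp.single j 1) = I j := by
  classical
  rw [multiPow, Finset.prod_eq_single j] <;> simp +contextual [eq_comm]

/-- A family of submodules stable under multiplication by the Rees algebra. -/
def IsReesStable (I : σ → Ideal R) {V : Type*} [AddCommGroup V] [Module R V]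
    (X : (σ →₀ ℕ) → Submodule R V) : Prop :=
  ∀ m n, multiPow I m • X n ≤ X (m + n)

/-- The multi-Rees algebra of a finite family of ideals, as the polynomials whose `n`-th
coefficient lies in `∏ j, I j ^ n j`. -/
def multiRees (I : σ → Ideal R) : Subalgebra R (MvPolynomial σ R) where
  carrier := {f | ∀ n, coeff n f ∈ multiPow I n}
  mul_mem' := by
    classical
    intro f g hf hg n
    rw [coeff_mul]
    refine Ideal.sum_mem _ fun x hx ↦ ?_
    rw [← Finset.HasAntidiagonal.mem_antidiagonal.1 hx, multiPow_add]
    exact Ideal.mul_mem_mul (hf _) (hg _)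
  add_mem' := by
    intro f g hf hg n
    rw [coeff_add]
    exact Ideal.add_mem _ (hf n) (hg n)
  algebraMap_mem' := by
    classical
    intro r n
    rw [MvPolynomial.algebraMap_eq, coeff_C]
    split_ifs with h
    · simp [← h, multiPow_zero]
    · simp

lemma monomial_mem_multiRees {I : σ → Ideal R} {n : σ →₀ ℕ} {a : R} (ha : a ∈ multiPow I n) :
    monomial n a ∈ multiRees I := by
  classical
  intro m
  rw [coeff_monomial]
  split_ifs with h
  · exact h ▸ ha
  · simp

/-- Finite generating sets of the ideals, with those of `I j` placed in degree e_j, generate the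
algebra. -/
lemma multiRees_fg [IsNoetherianRing R] (I : σ → Ideal R) : (multiRees I).FG := by
  classical
  choose s hs using fun j ↦ (isNoetherianRing_iff_ideal_fg R).1 inferInstance (I j)
  let S : Finset (MvPolynomial σ R) :=
    Finset.univ.biUnion fun j ↦ (s j).image (monomial (Finsupp.single j 1))
  -- `Q n` collects the coefficients a for which aXⁿ is generated; since `Q` is multiplicative, it
  -- suffices to check the degrees e_j.
  let Q (n : σ →₀ ℕ) : Ideal R :=
    (Subalgebra.toSubmodule (Algebra.adjoin R (S : Set (MvPolynomial σ R)))).comap (monomial n)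
  have hQmul (m n : σ →₀ ℕ) : Q m * Q n ≤ Q (m + n) := by
    refine Ideal.mul_le.2 fun a ha b hb ↦ ?_
    change monomial (m + n) (a * b) ∈ Algebra.adjoin R (S : Set (MvPolynomial σ R))
    rw [← monomial_mul]
    exact Subalgebra.mul_mem (Algebra.adjoin R (S : Set (MvPolynomial σ R))) ha hb
  have hQ0 : 1 ≤ Q 0 := by
    intro a _
    exact Subalgebra.algebraMap_mem (Algebra.adjoin R (S : Set (MvPolynomial σ R))) a
  have hQI (j : σ) : I j ≤ Q (Finsupp.single j 1) := by
    rw [← hs j, Ideal.span_le]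
    intro a ha
    refine Algebra.subset_adjoin ?_
    simp only [S, Finset.coe_biUnion, Set.mem_iUnion, Finset.coe_image]
    exact ⟨j, Finset.mem_univ j, a, ha, rfl⟩
  have hQpow (j : σ) (k : ℕ) : I j ^ k ≤ Q (Finsupp.single j k) := by
    induction k with
    | zero => simpa using hQ0
    | succ k ih =>
      rw [pow_succ, Finsupp.single_add]
      exact (Ideal.mul_mono ih (hQI j)).trans (hQmul _ _)
  have hQprod (n : σ →₀ ℕ) (u : Finset σ) :
      ∏ j ∈ u, I j ^ n j ≤ Q (∑ j ∈ u, Finsupp.single j (n j)) := by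
    induction u using Finset.induction_on with
    | empty => simpa using hQ0
    | insert j u hj ih =>
      rw [Finset.prod_insert hj, Finset.sum_insert hj]
      exact (Ideal.mul_mono (hQpow _ _) ih).trans (hQmul _ _)
  refine ⟨S, le_antisymm (Algebra.adjoin_le ?_) fun f hf ↦ ?_⟩
  · intro f hf
    simp only [S, Finset.coe_biUnion, Set.mem_iUnion, Finset.coe_image] at hf
    obtain ⟨j, -, a, ha, rfl⟩ := hf
    refine monomial_mem_multiRees ?_
    rw [multiPow_single, ← hs j]
    exact Ideal.subset_span ha
  · rw [f.as_sum]
    refine sum_mem fun n _ ↦ ?_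
    have h := hQprod n Finset.univ (hf n)
    rwa [Finsupp.univ_sum_single] at h

instance [IsNoetherianRing R] (I : σ → Ideal R) : IsNoetherianRing (multiRees I) :=
  isNoetherianRing_of_fg (multiRees_fg I)

variable {V : Type*} [AddCommGroup V] [Module R V] {r : ℕ}

/-- The degree `n` part of a vector over the multi-Rees algebra, as a combination of `v`. -/
noncomputable def multiReesEval (I : σ → Ideal R) (v : Fin r → V) (n : σ →₀ ℕ) :
    (Fin r → multiRees I) →ₗ[R] V where
  toFun g := ∑ i, coeff n (g i : MvPolynomial σ R) • v i
  map_add' g h := by simp [add_smul, Finset.sum_add_distrib]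
  map_smul' c g := by simp [mul_smul, Finset.smul_sum]

lemma multiReesEval_smul [DecidableEq σ] (I : σ → Ideal R) (v : Fin r → V) (n : σ →₀ ℕ)
    (ρ : multiRees I) (g : Fin r → multiRees I) :
    multiReesEval I v n (ρ • g) = ∑ x ∈ Finset.HasAntidiagonal.antidiagonal n,
      coeff x.1 (ρ : MvPolynomial σ R) • multiReesEval I v x.2 g := by
  simp only [multiReesEval, LinearMap.coe_mk, AddHom.coe_mk, Pi.smul_apply, smul_eq_mul,
    MulMemClass.coe_mul, coeff_mul, Finset.sum_smul, Finset.smul_sum, mul_smul]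
  exact Finset.sum_comm

/-- Homogeneous lifting: the vector of monomials in degree n built from the coefficients of x has no
component in any other degree. -/
lemma exists_multiReesEval_eq (I : σ → Ideal R) (v : Fin r → V) {n : σ →₀ ℕ} {x : V}
    (hx : x ∈ multiPow I n • Submodule.span R (Set.range v)) :
    ∃ g : Fin r → multiRees I, multiReesEval I v n g = x ∧
      ∀ m ≠ n, multiReesEval I v m g = 0 := by
  classical
  obtain ⟨a, ha, rfl⟩ := (Submodule.mem_ideal_smul_span_iff_exists_sum _ _ _).1 hx
  refine ⟨fun i ↦ ⟨monomial n (a i), monomial_mem_multiRees (ha i)⟩, ?_, fun m hm ↦ ?_⟩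
  · simp [multiReesEval, Finsupp.sum_fintype]
  · simp [multiReesEval, coeff_monomial, hm.symm]

lemma exists_bound_multiReesEval (I : σ → Ideal R) (v : Fin r → V) (g : Fin r → multiRees I) :
    ∃ k : σ →₀ ℕ, ∀ n, ¬ n ≤ k → multiReesEval I v n g = 0 := by
  classical
  refine ⟨Finset.univ.sup fun i ↦ (g i : MvPolynomial σ R).support.sup id, fun n hn ↦ ?_⟩
  rw [multiReesEval, LinearMap.coe_mk, AddHom.coe_mk]
  refine Finset.sum_eq_zero fun i _ ↦ ?_
  rw [notMem_support_iff.1, zero_smul]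
  exact fun h ↦ hn ((Finset.le_sup (f := id) h).trans
    (Finset.le_sup (f := fun i ↦ (g i : MvPolynomial σ R).support.sup id) (Finset.mem_univ i)))

/-- The homogeneous submodule attached to a stable family. -/
noncomputable def multiReesSubmodule {I : σ → Ideal R} (v : Fin r → V)
    {X : (σ →₀ ℕ) → Submodule R V} (hX : IsReesStable I X) :
    Submodule (multiRees I) (Fin r → multiRees I) where
  carrier := {g | ∀ n, multiReesEval I v n g ∈ X n}
  add_mem' hf hg n := by
    rw [map_add]
    exact add_mem (hf n) (hg n)
  zero_mem' n := by simp
  smul_mem' ρ g hg n := by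
    classical
    rw [multiReesEval_smul]
    refine sum_mem fun x hx ↦ ?_
    rw [← Finset.HasAntidiagonal.mem_antidiagonal.1 hx]
    exact hX _ _ (Submodule.smul_mem_smul (ρ.2 _) (hg _))

lemma mem_multiReesSubmodule {I : σ → Ideal R} {v : Fin r → V}
    {X : (σ →₀ ℕ) → Submodule R V} {hX : IsReesStable I X} {g : Fin r → multiRees I} :
    g ∈ multiReesSubmodule v hX ↔ ∀ n, multiReesEval I v n g ∈ X n := Iff.rfl

/-- The Artin–Rees lemma for several ideals: a stable family contained in `∏ j, I j ^ n j • W` is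
eventually generated by one of its members. -/
theorem IsReesStable.exists_le_smul [IsNoetherianRing R] {I : σ → Ideal R}
    {X : (σ →₀ ℕ) → Submodule R V} (hX : IsReesStable I X) {W : Submodule R V} (hW : W.FG)
    (hXW : ∀ n, X n ≤ multiPow I n • W) :
    ∃ l, ∀ m, X (m + l) ≤ multiPow I m • X l := by
  classical
  obtain ⟨r, v, rfl⟩ := Submodule.fg_iff_exists_fin_generating_family.1 hW
  obtain ⟨G, hG⟩ := IsNoetherian.noetherian (multiReesSubmodule v hX)
  choose k hk using exists_bound_multiReesEval I v
  -- The generators in `G` need not be homogeneous, but all their nonzero components lie in degrees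
  -- bounded by this supremum.
  refine ⟨G.sup k, fun m x hx ↦ ?_⟩
  obtain ⟨g, rfl, hg⟩ := exists_multiReesEval_eq I v (hXW _ hx)
  have hgX : g ∈ multiReesSubmodule v hX := by
    intro n
    by_cases hn : n = m + G.sup k
    · exact hn ▸ hx
    · simp [hg n hn]
  rw [← hG, Submodule.mem_span_finset] at hgX
  obtain ⟨ρ, -, rfl⟩ := hgX
  rw [map_sum]
  refine sum_mem fun h hh ↦ ?_
  rw [multiReesEval_smul]
  refine sum_mem fun y hy ↦ ?_
  -- A contributing component of `h` has degree at most l, so its coefficient has degree m + d: the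
  -- factor Iᵈ lifts the component into `X l` and Iᵐ remains.
  by_cases hyk : y.2 ≤ k h
  · obtain ⟨d, hd⟩ := exists_add_of_le (hyk.trans (Finset.le_sup hh))
    have hy1 : y.1 = m + d := by
      have := Finset.HasAntidiagonal.mem_antidiagonal.1 hy
      rw [hd, add_comm y.2 d, ← add_assoc] at this
      exact add_right_cancel this
    have h1 : coeff y.1 (ρ h : MvPolynomial σ R) ∈ multiPow I m * multiPow I d := by
      rw [← multiPow_add, ← hy1]
      exact (ρ h).2 _
    have h2 : multiReesEval I v y.2 h ∈ X y.2 :=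
      mem_multiReesSubmodule.1 (hG ▸ Submodule.subset_span hh) _
    have h3 := Submodule.smul_mem_smul h1 h2
    rw [mul_smul] at h3
    refine Submodule.smul_mono le_rfl ?_ h3
    rw [hd, add_comm]
    exact hX _ _
  · rw [hk h _ hyk, smul_zero]
    exact zero_mem _

/-- The prime ideals of `R` which are annihilators of elements of a finitely generated module over
a Noetherian `R`-algebra are finite in number. -/
theorem finite_setOf_isPrime_eq_annihilator {R A L : Type*} [CommRing R] [CommRing A] [Algebra R A]
    [IsNoetherianRing A] [AddCommGroup L] [Module A L] [Module.Finite A L] :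
    {p : Ideal R | p.IsPrime ∧ ∃ x : L, ∀ c, c ∈ p ↔ algebraMap R A c • x = 0}.Finite := by
  induction ‹Module.Finite A L› using
    IsNoetherianRing.induction_on_isQuotientEquivQuotientPrime A with
  | subsingleton N =>
    refine Set.finite_empty.subset ?_
    rintro p ⟨hp, x, hx⟩
    exact hp.ne_top ((Ideal.eq_top_iff_one _).2 ((hx 1).2 (Subsingleton.elim _ _)))
  | quotient N q e =>
    refine (Set.finite_singleton (q.1.comap (algebraMap R A))).subset ?_
    rintro p ⟨hp, x, hx⟩
    have hx0 : e x ≠ 0 := by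
      rw [Ne, e.map_eq_zero_iff]
      rintro rfl
      exact hp.ne_top ((Ideal.eq_top_iff_one _).2 ((hx 1).2 (smul_zero _)))
    ext c
    -- In the domain A/q every nonzero element has annihilator q, so p must be the contraction of q.
    rw [hx, ← e.map_eq_zero_iff, map_smul, Ideal.mem_comap, Algebra.smul_def, mul_eq_zero,
      or_iff_left hx0]
    exact Ideal.Quotient.eq_zero_iff_mem
  | exact N₁ N₂ N₃ f g hf _ hfg h₁ h₃ =>
    refine (h₁.union h₃).subset ?_
    rintro p ⟨hp, x, hx⟩
    -- A multiple of x by an element outside the prime p still has annihilator p. If such a multiple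
    -- comes from N₁, then p occurs there; otherwise p is the annihilator of the image of x in N₃.
    by_cases! h : ∃ a ∉ p, ∃ y, f y = algebraMap R A a • x
    · obtain ⟨a, ha, y, hy⟩ := h
      refine Or.inl ⟨hp, y, fun c ↦ ?_⟩
      rw [← map_eq_zero_iff f hf, map_smul, hy, ← mul_smul, ← map_mul, ← hx]
      exact ⟨fun hc ↦ Ideal.mul_mem_right _ _ hc, fun hc ↦ (hp.mem_or_mem hc).resolve_right ha⟩
    · refine Or.inr ⟨hp, g x, fun c ↦ ⟨fun hc ↦ ?_, fun hc ↦ ?_⟩⟩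
      · rw [← map_smul, (hx c).1 hc, map_zero]
      · rw [← map_smul] at hc
        obtain ⟨y, hy⟩ := (hfg _).1 hc
        by_contra hcp
        exact h c hcp y hy

theorem finite_setOf_isPrime_eq_colon {R A L : Type*} [CommRing R] [CommRing A] [Algebra R A]
    [IsNoetherianRing A] [AddCommGroup L] [Module A L] [Module.Finite A L] (U : Submodule A L) :
    {p : Ideal R | p.IsPrime ∧ ∃ x : L, ∀ c, c ∈ p ↔ algebraMap R A c • x ∈ U}.Finite := by
  refine (finite_setOf_isPrime_eq_annihilator (R := R) (A := A) (L := L ⧸ U)).subset ?_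
  rintro p ⟨hp, x, hx⟩
  refine ⟨hp, Submodule.Quotient.mk x, fun c ↦ ?_⟩
  rw [hx, ← Submodule.Quotient.mk_smul, Submodule.Quotient.mk_eq_zero]

/-- `p` is a prime of the form `(Y : x)` with `x ∈ Z`; that is, for `Y ≤ Z` over a Noetherian ring,
an associated prime of `Z / Y`. -/
def IsPrimeColon (p : Ideal R) (Z Y : Submodule R V) : Prop :=
  p.IsPrime ∧ ∃ x ∈ Z, ∀ c, c ∈ p ↔ c • x ∈ Y

/-- A homogeneous lift of x has the same colon ideal in R with respect to `multiReesSubmodule`, so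
all degrees n are handled by one finitely generated module over the multi-Rees algebra. -/
theorem IsReesStable.finite_setOf_isPrimeColon [IsNoetherianRing R] {I : σ → Ideal R}
    {Y : (σ →₀ ℕ) → Submodule R V} (hY : IsReesStable I Y) {W : Submodule R V} (hW : W.FG) :
    {p : Ideal R | ∃ n, IsPrimeColon p (multiPow I n • W) (Y n)}.Finite := by
  obtain ⟨r, v, rfl⟩ := Submodule.fg_iff_exists_fin_generating_family.1 hW
  refine (finite_setOf_isPrime_eq_colon (R := R) (multiReesSubmodule v hY)).subset ?_
  rintro p ⟨n, hp, x, hx, hpx⟩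
  obtain ⟨g, rfl, hg⟩ := exists_multiReesEval_eq I v hx
  refine ⟨hp, g, fun c ↦ ?_⟩
  rw [hpx, mem_multiReesSubmodule]
  simp only [algebraMap_smul, map_smul]
  refine ⟨fun h m ↦ ?_, fun h ↦ h n⟩
  by_cases hm : m = n
  · exact hm ▸ h
  · simp [hg m hm]

end MultiRees

/-! ### Stability of the associated primes of Zₙ/IⁿE. -/

section AsymptoticPrimes

variable {R : Type*} [CommRing R] {V : Type*} [AddCommGroup V] [Module R V]

lemma IsPrimeColon.mono {p : Ideal R} {Z Z' Y : Submodule R V} (h : IsPrimeColon p Z Y)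
    (hZ : Z ≤ Z') : IsPrimeColon p Z' Y :=
  ⟨h.1, h.2.imp fun _ hx ↦ ⟨hZ hx.1, hx.2⟩⟩

/-- The analogue of Ass(Z/Y) ⊆ Ass(Z'/Y) ∪ Ass(Z/Z'): either some multiple of x by an element
outside p falls into Z', or p is already the colon of x with respect to Z'. -/
lemma IsPrimeColon.or_of_le {p : Ideal R} {Z Z' Y : Submodule R V} (h : IsPrimeColon p Z Y)
    (hY : Y ≤ Z') : IsPrimeColon p Z' Y ∨ IsPrimeColon p Z Z' := by
  obtain ⟨hp, x, hxZ, hx⟩ := h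
  by_cases! hs : ∃ s ∉ p, s • x ∈ Z'
  · obtain ⟨s, hsp, hsx⟩ := hs
    refine Or.inl ⟨hp, s • x, hsx, fun c ↦ ?_⟩
    rw [← mul_smul, ← hx]
    exact ⟨fun hc ↦ Ideal.mul_mem_right _ _ hc, fun hc ↦ (hp.mem_or_mem hc).resolve_right hsp⟩
  · refine Or.inr ⟨hp, x, hxZ, fun c ↦ ⟨fun hc ↦ hY ((hx c).1 hc), fun hc ↦ ?_⟩⟩
    by_contra hcp
    exact hs c hcp hc

lemma isPrimeColon_comap_iff {V' : Type*} [AddCommGroup V'] [Module R V'] {q : V →ₗ[R] V'}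
    (hq : Function.Surjective q) {p : Ideal R} {Z Y : Submodule R V'} :
    IsPrimeColon p (Z.comap q) (Y.comap q) ↔ IsPrimeColon p Z Y := by
  simp [IsPrimeColon, hq.exists]

/-- Associated primes of a module presented as `Z / Y`. -/
lemma mem_associatedPrimes_iff_isPrimeColon [IsNoetherianRing R] {H : Type*} [AddCommGroup H]
    [Module R H] {Z Y : Submodule R V} (θ : Z →ₗ[R] H) (hθ : Function.Surjective θ)
    (hker : ∀ z : Z, θ z = 0 ↔ (z : V) ∈ Y) {p : Ideal R} :
    p ∈ associatedPrimes R H ↔ IsPrimeColon p Z Y := by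
  rw [AssociatedPrimes.mem_iff, isAssociatedPrime_iff, IsPrimeColon, hθ.exists]
  refine and_congr_right fun _ ↦ ⟨?_, ?_⟩
  · rintro ⟨z, rfl⟩
    refine ⟨z, z.2, fun c ↦ ?_⟩
    rw [Submodule.mem_colon_singleton, Submodule.mem_bot, ← map_smul, hker, Submodule.coe_smul]
  · rintro ⟨z, hz, h⟩
    refine ⟨⟨z, hz⟩, Ideal.ext fun c ↦ ?_⟩
    rw [Submodule.mem_colon_singleton, Submodule.mem_bot, ← map_smul, hker, Submodule.coe_smul, h]

/-- The elements of `V` whose image in the localization at the prime `p` lies in that of `Y`. -/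
def primeSaturation (p : Ideal R) [hp : p.IsPrime] (Y : Submodule R V) : Submodule R V where
  carrier := {x | ∃ s ∉ p, s • x ∈ Y}
  add_mem' := by
    rintro x y ⟨s, hs, hx⟩ ⟨u, hu, hy⟩
    refine ⟨u * s, fun h ↦ (hp.mem_or_mem h).elim hu hs, ?_⟩
    rw [smul_add]
    refine add_mem ?_ ?_
    · rw [mul_smul]
      exact Y.smul_mem _ hx
    · rw [mul_comm, mul_smul]
      exact Y.smul_mem _ hy
  zero_mem' := ⟨1, fun h ↦ hp.ne_top ((Ideal.eq_top_iff_one _).2 h), by simp⟩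
  smul_mem' := by
    rintro c x ⟨s, hs, hx⟩
    refine ⟨s, hs, ?_⟩
    rw [smul_comm]
    exact Y.smul_mem _ hx

lemma primeSaturation_mono {p : Ideal R} [p.IsPrime] {Y Y' : Submodule R V} (h : Y ≤ Y') :
    primeSaturation p Y ≤ primeSaturation p Y' :=
  fun _ ⟨s, hs, hx⟩ ↦ ⟨s, hs, h hx⟩

lemma smul_primeSaturation_le {p : Ideal R} [p.IsPrime] (J : Ideal R) (Y : Submodule R V) :
    J • primeSaturation p Y ≤ primeSaturation p (J • Y) := by
  refine Submodule.smul_le.2 ?_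
  rintro a ha x ⟨s, hs, hx⟩
  refine ⟨s, hs, ?_⟩
  rw [smul_comm]
  exact Submodule.smul_mem_smul ha hx

/-- If px ⊆ Y and x does not vanish modulo Y at p, nothing outside p can carry x into Y, so (Y : x)
is exactly p. -/
lemma isPrimeColon_iff_not_le_primeSaturation {p : Ideal R} [hp : p.IsPrime]
    {Z Y L : Submodule R V} (hL : ∀ x, x ∈ L ↔ x ∈ Z ∧ ∀ a ∈ p, a • x ∈ Y) :
    IsPrimeColon p Z Y ↔ ¬ L ≤ primeSaturation p Y := by
  rw [SetLike.not_le_iff_exists]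
  constructor
  · rintro ⟨-, x, hxZ, hx⟩
    refine ⟨x, (hL x).2 ⟨hxZ, fun a ↦ (hx a).1⟩, ?_⟩
    rintro ⟨s, hs, hsx⟩
    exact hs ((hx s).2 hsx)
  · rintro ⟨x, hxL, hx⟩
    obtain ⟨hxZ, hxp⟩ := (hL x).1 hxL
    refine ⟨hp, x, hxZ, fun c ↦ ⟨hxp c, fun hc ↦ ?_⟩⟩
    by_contra hcp
    exact hx ⟨c, hcp, hc⟩

lemma Submodule.smul_prod {C : Type*} [AddCommGroup C] [Module R C] (J : Ideal R)
    (A : Submodule R C) (E : Submodule R V) : J • A.prod E = (J • A).prod (J • E) := by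
  refine le_antisymm (Submodule.smul_le.2 fun a ha x hx ↦
    ⟨Submodule.smul_mem_smul ha hx.1, Submodule.smul_mem_smul ha hx.2⟩) ?_
  rintro ⟨x, y⟩ ⟨hx, hy⟩
  have h1 : (J • A).map (LinearMap.inl R C V) ≤ J • A.prod E := by
    rw [Submodule.map_smul'']
    refine Submodule.smul_mono le_rfl ?_
    rintro _ ⟨z, hz, rfl⟩
    exact ⟨hz, zero_mem _⟩
  have h2 : (J • E).map (LinearMap.inr R C V) ≤ J • A.prod E := by
    rw [Submodule.map_smul'']
    refine Submodule.smul_mono le_rfl ?_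
    rintro _ ⟨z, hz, rfl⟩
    exact ⟨zero_mem _, hz⟩
  simpa using add_mem (h1 ⟨x, hx, rfl⟩) (h2 ⟨y, hy, rfl⟩)

lemma Submodule.smul_pi_const {ι : Type*} [Finite ι] (J : Ideal R) (E : Submodule R V) :
    J • Submodule.pi Set.univ (fun _ : ι ↦ E) = Submodule.pi Set.univ fun _ ↦ J • E := by
  classical
  have := Fintype.ofFinite ι
  refine le_antisymm (Submodule.smul_le.2 fun a ha x hx i hi ↦
    Submodule.smul_mem_smul ha (hx i hi)) fun x hx ↦ ?_
  rw [← Finset.univ_sum_single x]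
  refine sum_mem fun i _ ↦ ?_
  have h : (J • E).map (LinearMap.single R (fun _ : ι ↦ V) i) ≤
      J • Submodule.pi Set.univ (fun _ : ι ↦ E) := by
    rw [Submodule.map_smul'']
    refine Submodule.smul_mono le_rfl ?_
    rintro _ ⟨y, hy, rfl⟩ k -
    by_cases hk : k = i
    · subst hk
      simpa using hy
    · simp [hk]
  exact h ⟨x i, hx i trivial, rfl⟩

variable {σ : Type*} [Fintype σ] [IsNoetherianRing R]

/-- Artin–Rees for inverse images. -/
lemma exists_comap_multiPow_smul_le (I : σ → Ideal R) {C : Type*} [AddCommGroup C] [Module R C]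
    (Φ : V →ₗ[R] C) {G : Submodule R C} (hG : G.FG) :
    ∃ l, ∀ m, (multiPow I (m + l) • G).comap Φ ≤
      LinearMap.ker Φ ⊔ multiPow I m • (multiPow I l • G).comap Φ := by
  -- This is IⁿG ∩ im Φ, the family of the classical Artin–Rees lemma; pulling back along Φ
  -- reintroduces ker Φ.
  let X (n : σ →₀ ℕ) : Submodule R C := ((multiPow I n • G).comap Φ).map Φ
  have hX : IsReesStable I X := by
    intro m n
    rw [← Submodule.map_smul'']
    refine Submodule.map_mono (Submodule.smul_le.2 fun a ha x hx ↦ ?_)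
    rw [Submodule.mem_comap, map_smul, multiPow_add, mul_smul]
    exact Submodule.smul_mem_smul ha hx
  obtain ⟨l, hl⟩ := hX.exists_le_smul hG fun n ↦ Submodule.map_comap_le _ _
  refine ⟨l, fun m x hx ↦ ?_⟩
  have h := hl m (Submodule.mem_map_of_mem hx)
  rw [← Submodule.map_smul''] at h
  rw [sup_comm, ← Submodule.comap_map_eq]
  exact h

/-- Descend from IⁿE to V by lowering one exponent at a time; each prime comes from V/E or from a
layer IᵈE/I^(e_j+d)E, and there are finitely many directions j. -/
lemma finite_setOf_isPrimeColon_multiPow_smul [Module.Finite R V] (I : σ → Ideal R)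
    (E : Submodule R V) :
    {p : Ideal R | ∃ n, IsPrimeColon p ⊤ (multiPow I n • E)}.Finite := by
  classical
  have hE : E.FG := IsNoetherian.noetherian E
  have h0 : {p : Ideal R | IsPrimeColon p ⊤ E}.Finite := by
    refine (finite_setOf_isPrime_eq_colon (A := R) E).subset ?_
    rintro p ⟨hp, x, -, hx⟩
    exact ⟨hp, x, hx⟩
  have h1 (j : σ) : {p : Ideal R | ∃ n, IsPrimeColon p (multiPow I n • E)
      (multiPow I (Finsupp.single j 1 + n) • E)}.Finite := by
    refine IsReesStable.finite_setOf_isPrimeColon (fun m n ↦ ?_) hE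
    rw [← mul_smul, ← multiPow_add, add_left_comm]
  refine (h0.union (Set.finite_iUnion h1)).subset ?_
  rintro p ⟨n, hn⟩
  induction n using WellFoundedLT.induction with
  | ind n ih =>
    by_cases hn0 : n = 0
    · rw [hn0, multiPow_zero, one_smul] at hn
      exact Or.inl hn
    · obtain ⟨j, hj⟩ := Finsupp.ne_iff.1 hn0
      obtain ⟨d, rfl⟩ : ∃ d, n = Finsupp.single j 1 + d := by
        refine exists_add_of_le (Finsupp.single_le_iff.2 ?_)
        exact Nat.one_le_iff_ne_zero.2 hj
      obtain h | h := hn.or_of_le (Submodule.smul_mono_left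
        (multiPow_antitone I le_add_self)) (Z' := multiPow I d • E)
      · exact Or.inr (Set.mem_iUnion.2 ⟨j, d, h⟩)
      · exact ih d (lt_add_of_pos_left d (by simp [pos_iff_ne_zero])) h

lemma exists_forall_ge_isPrimeColon_iff [Module.Finite R V] (I : σ → Ideal R) {C : Type*}
    [AddCommGroup C] [Module R C] [Module.Finite R C] (g : V →ₗ[R] C) (C' : Submodule R C)
    (E : Submodule R V) (p : Ideal R) :
    ∃ (k : σ →₀ ℕ) (P : Prop), ∀ n ≥ k,
      (IsPrimeColon p ((multiPow I n • C').comap g) (multiPow I n • E) ↔ P) := by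
  by_cases hp : p.IsPrime
  swap
  · exact ⟨0, False, fun n _ ↦ iff_false_intro fun h ↦ hp h.1⟩
  obtain ⟨r, a, ha⟩ := Submodule.fg_iff_exists_fin_generating_family.1
    ((isNoetherianRing_iff_ideal_fg R).1 inferInstance p)
  -- With generators a_i of p, the map x ↦ (g x, (a_i x)_i) turns both conditions defining Lₙ into
  -- the single one Φ x ∈ IⁿG.
  let Φ : V →ₗ[R] C × (Fin r → V) := g.prod (LinearMap.pi fun i ↦ a i • LinearMap.id)
  let G : Submodule R (C × (Fin r → V)) := C'.prod (Submodule.pi Set.univ fun _ ↦ E)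
  let L (n : σ →₀ ℕ) : Submodule R V := (multiPow I n • G).comap Φ
  have hL (n : σ →₀ ℕ) (x : V) : x ∈ L n ↔
      x ∈ (multiPow I n • C').comap g ∧ ∀ c ∈ p, c • x ∈ multiPow I n • E := by
    have h1 : (∀ c ∈ p, c • x ∈ multiPow I n • E) ↔ ∀ i, a i • x ∈ multiPow I n • E := by
      refine ⟨fun h i ↦ h _ (ha ▸ Submodule.subset_span ⟨i, rfl⟩), fun h ↦ ?_⟩
      change p ≤ (multiPow I n • E).comap (LinearMap.toSpanSingleton R V x)
      rw [← ha, Submodule.span_le]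
      rintro _ ⟨i, rfl⟩
      exact h i
    rw [h1, Submodule.mem_comap, Submodule.smul_prod, Submodule.smul_pi_const]
    simp [Φ, Submodule.mem_prod, Submodule.mem_pi]
  obtain ⟨l, hl⟩ := exists_comap_multiPow_smul_le I Φ (G := G) (IsNoetherian.noetherian _)
  have hker (n : σ →₀ ℕ) : LinearMap.ker Φ ≤ L n := fun x hx ↦ by
    rw [Submodule.mem_comap, LinearMap.mem_ker.1 hx]
    exact zero_mem _
  have hLl (m : σ →₀ ℕ) : multiPow I m • L l ≤ L (m + l) := by
    refine Submodule.smul_le.2 fun c hc x hx ↦ ?_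
    rw [Submodule.mem_comap, map_smul, multiPow_add, mul_smul]
    exact Submodule.smul_mem_smul hc hx
  have hQ (m : σ →₀ ℕ) :
      (IsPrimeColon p ((multiPow I (m + l) • C').comap g) (multiPow I (m + l) • E) ↔
      ¬ (LinearMap.ker Φ ≤ primeSaturation p (multiPow I (m + l) • E) ∧
        multiPow I m • L l ≤ primeSaturation p (multiPow I (m + l) • E))) := by
    rw [isPrimeColon_iff_not_le_primeSaturation (hL _), ← sup_le_iff, not_iff_not]
    exact ⟨(sup_le (hker _) (hLl _)).trans, (hl m).trans⟩
  -- The saturations of IⁿE shrink as n grows, so a failure of ker Φ to be contained persists.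
  by_cases! hA : ∃ m₀, ¬ LinearMap.ker Φ ≤ primeSaturation p (multiPow I (m₀ + l) • E)
  · obtain ⟨m₀, hm₀⟩ := hA
    refine ⟨m₀ + l, True, fun n hn ↦ iff_true_intro ?_⟩
    obtain ⟨d, rfl⟩ := exists_add_of_le hn
    rw [show m₀ + l + d = m₀ + d + l by abel, hQ]
    rintro ⟨h, -⟩
    refine hm₀ (h.trans (primeSaturation_mono (Submodule.smul_mono_left (multiPow_antitone I ?_))))
    gcongr
    exact le_self_add
  -- Here ker Φ is always contained, and multiplying by Iᵈ propagates the other containment upward.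
  by_cases! hB : ∃ m₀, multiPow I m₀ • L l ≤ primeSaturation p (multiPow I (m₀ + l) • E)
  · obtain ⟨m₀, hm₀⟩ := hB
    refine ⟨m₀ + l, False, fun n hn ↦ iff_false_intro ?_⟩
    obtain ⟨d, rfl⟩ := exists_add_of_le hn
    rw [show m₀ + l + d = d + m₀ + l by abel, hQ, not_not]
    refine ⟨hA _, ?_⟩
    rw [add_assoc d, multiPow_add, multiPow_add I d (m₀ + l), mul_smul, mul_smul]
    exact (Submodule.smul_mono le_rfl hm₀).trans (smul_primeSaturation_le _ _)
  · refine ⟨l, True, fun n hn ↦ iff_true_intro ?_⟩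
    obtain ⟨d, rfl⟩ := exists_add_of_le hn
    rw [add_comm, hQ]
    exact fun h ↦ hB d h.2

theorem exists_forall_ge_forall_isPrimeColon_iff [Module.Finite R V] (I : σ → Ideal R) {C : Type*}
    [AddCommGroup C] [Module R C] [Module.Finite R C] (g : V →ₗ[R] C) (C' : Submodule R C)
    (E : Submodule R V) :
    ∃ k : σ →₀ ℕ, ∀ m ≥ k, ∀ n ≥ k, ∀ p,
      (IsPrimeColon p ((multiPow I m • C').comap g) (multiPow I m • E) ↔
        IsPrimeColon p ((multiPow I n • C').comap g) (multiPow I n • E)) := by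
  classical
  choose k P hP using exists_forall_ge_isPrimeColon_iff I g C' E
  have hfin := finite_setOf_isPrimeColon_multiPow_smul I E
  -- Thresholds are needed only for the finitely many candidate primes; for any other p both sides
  -- are false.
  refine ⟨hfin.toFinset.sup k, fun m hm n hn p ↦ ?_⟩
  by_cases hp : p ∈ {p : Ideal R | ∃ n, IsPrimeColon p ⊤ (multiPow I n • E)}
  · have h : k p ≤ hfin.toFinset.sup k := Finset.le_sup (hfin.mem_toFinset.2 hp)
    rw [hP p m (h.trans hm), hP p n (h.trans hn)]
  · exact iff_of_false (fun h ↦ hp ⟨_, h.mono le_top⟩) fun h ↦ hp ⟨_, h.mono le_top⟩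

/-- Asymptotic stability of the associated primes of the homology of
`A → B / I ^ n B' → C / I ^ n C'`. -/
theorem exists_forall_ge_associatedPrimes_eq (I : σ → Ideal R) {A B C : Type*} [AddCommGroup A]
    [Module R A] [AddCommGroup B] [Module R B] [Module.Finite R B] [AddCommGroup C] [Module R C]
    [Module.Finite R C] (f : A →ₗ[R] B) (g : B →ₗ[R] C) (hfg : g ∘ₗ f = 0) (B' : Submodule R B)
    (C' : Submodule R C) {H : (σ →₀ ℕ) → Type*} [∀ n, AddCommGroup (H n)] [∀ n, Module R (H n)]
    (hH : ∀ n, ∃ θ : (multiPow I n • C').comap g →ₗ[R] H n, Function.Surjective θ ∧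
      ∀ z, θ z = 0 ↔ (z : B) ∈ LinearMap.range f ⊔ multiPow I n • B') :
    ∃ k : σ →₀ ℕ, ∀ m ≥ k, ∀ n ≥ k, associatedPrimes R (H m) = associatedPrimes R (H n) := by
  have hrange : LinearMap.range f ≤ LinearMap.ker g := LinearMap.range_le_ker_iff.2 hfg
  -- Modulo im f the denominator im f + IⁿB' becomes IⁿE, with E the image of B'.
  let q := (LinearMap.range f).mkQ
  obtain ⟨k, hk⟩ := exists_forall_ge_forall_isPrimeColon_iff I
    ((LinearMap.range f).liftQ g hrange) C' (B'.map q)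
  have key (n : σ →₀ ℕ) (p : Ideal R) : p ∈ associatedPrimes R (H n) ↔
      IsPrimeColon p ((multiPow I n • C').comap ((LinearMap.range f).liftQ g hrange))
        (multiPow I n • B'.map q) := by
    obtain ⟨θ, hθ, hθ0⟩ := hH n
    rw [mem_associatedPrimes_iff_isPrimeColon θ hθ hθ0,
      ← isPrimeColon_comap_iff (Submodule.mkQ_surjective (LinearMap.range f)),
      ← Submodule.map_smul'', Submodule.comap_map_eq, Submodule.ker_mkQ, sup_comm,
      ← Submodule.comap_comp, Submodule.liftQ_mkQ]
  refine ⟨k, fun m hm n hn ↦ Set.ext fun p ↦ ?_⟩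
  rw [key, key, hk m hm n hn]

end AsymptoticPrimes

/-! ### Resolutions by free modules, of finite rank in the Noetherian case. -/

section Resolution

open Limits

variable {R : Type u} [CommRing R]

/-- A choice valid for every module allows the resolution to be built without finiteness hypotheses;
finite rank is then proved term by term. -/
lemma exists_span_eq_top_and_finite (X : Type u) [AddCommGroup X] [Module R X] :
    ∃ s : Set X, Submodule.span R s = ⊤ ∧ (Module.Finite R X → s.Finite) := by
  by_cases h : Module.Finite R X
  · obtain ⟨s, hs⟩ := h.fg_top
    exact ⟨s, hs, fun _ ↦ s.finite_toSet⟩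
  · exact ⟨Set.univ, Submodule.span_univ, fun h' ↦ (h h').elim⟩

namespace ModuleCat

/-- A generating set which is finite if the module is finitely generated. -/
noncomputable def generators (X : ModuleCat.{u} R) : Set X :=
  (exists_span_eq_top_and_finite (R := R) X).choose

/-- The free module on `X.generators`. -/
noncomputable abbrev freeCover (X : ModuleCat.{u} R) : ModuleCat.{u} R :=
  ModuleCat.of R (X.generators →₀ R)

/-- The projection from `X.freeCover` to `X`. -/
noncomputable def freeCoverπ (X : ModuleCat.{u} R) : X.freeCover ⟶ X :=
  ModuleCat.ofHom (Finsupp.linearCombination R (Subtype.val : X.generators → X))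

instance (X : ModuleCat.{u} R) : Epi X.freeCoverπ := by
  rw [ModuleCat.epi_iff_range_eq_top]
  change LinearMap.range (Finsupp.linearCombination R _) = ⊤
  rw [Finsupp.range_linearCombination, Subtype.range_coe]
  exact (exists_span_eq_top_and_finite (R := R) X).choose_spec.1

instance (X : ModuleCat.{u} R) : Projective X.freeCover :=
  ModuleCat.projective_of_free (Module.Free.chooseBasis R _)

instance (X : ModuleCat.{u} R) [h : Module.Finite R X] : Module.Finite R X.freeCover := by
  have : Finite X.generators :=
    ((exists_span_eq_top_and_finite (R := R) X).choose_spec.2 h).to_subtype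
  exact Module.Finite.finsupp

/-- The next differential of a free resolution ending in `f`. -/
noncomputable def freeD {X Y : ModuleCat.{u} R} (f : X ⟶ Y) : (kernel f).freeCover ⟶ X :=
  (kernel f).freeCoverπ ≫ kernel.ι f

lemma freeD_comp {X Y : ModuleCat.{u} R} (f : X ⟶ Y) : freeD f ≫ f = 0 := by
  simp [freeD]

/-- Precomposing the kernel inclusion with an epimorphism does not change its image. -/
lemma exact_freeD {X Y : ModuleCat.{u} R} (f : X ⟶ Y) :
    (ShortComplex.mk (freeD f) f (freeD_comp f)).Exact := by
  let α : ShortComplex.mk (freeD f) f (freeD_comp f) ⟶ ShortComplex.mk (kernel.ι f) f (by simp) :=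
    { τ₁ := (kernel f).freeCoverπ
      τ₂ := 𝟙 _
      τ₃ := 𝟙 _
      comm₁₂ := by simp [freeD] }
  have : Epi α.τ₁ := inferInstanceAs (Epi (kernel f).freeCoverπ)
  have : IsIso α.τ₂ := inferInstanceAs (IsIso (𝟙 _))
  have : Mono α.τ₃ := inferInstanceAs (Mono (𝟙 _))
  rw [ShortComplex.exact_iff_of_epi_of_isIso_of_mono α]
  exact ShortComplex.exact_of_f_is_kernel _ (kernelIsKernel f)

instance [IsNoetherianRing R] {X Y : ModuleCat.{u} R} [Module.Finite R X] (f : X ⟶ Y) :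
    Module.Finite R (kernel f : ModuleCat.{u} R) :=
  Module.Finite.of_injective (kernel.ι f).hom ((ModuleCat.mono_iff_injective _).1 inferInstance)

/-- The `n`-th map of a free resolution of `Z`, starting with the projection to `Z`. -/
noncomputable def freeArrow (Z : ModuleCat.{u} R) : ℕ → Arrow (ModuleCat.{u} R)
  | 0 => Arrow.mk Z.freeCoverπ
  | n + 1 => Arrow.mk (freeD (freeArrow Z n).hom)

/-- A free resolution of `Z`, as a complex. -/
noncomputable def freeComplex (Z : ModuleCat.{u} R) : ChainComplex (ModuleCat.{u} R) ℕ :=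
  ChainComplex.of (fun n ↦ (freeArrow Z n).left) (fun n ↦ freeD (freeArrow Z n).hom)
    fun n ↦ freeD_comp (freeD (freeArrow Z n).hom)

lemma freeComplex_d (Z : ModuleCat.{u} R) (n : ℕ) :
    (freeComplex Z).d (n + 1) n = freeD (freeArrow Z n).hom :=
  ChainComplex.of_d (fun n ↦ (freeArrow Z n).left) (fun n ↦ freeD (freeArrow Z n).hom) n

lemma freeComplex_exactAt_succ (Z : ModuleCat.{u} R) (n : ℕ) :
    (freeComplex Z).ExactAt (n + 1) := by
  rw [HomologicalComplex.exactAt_iff' _ (n + 1 + 1) (n + 1) n (by simp) (by simp),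
    ShortComplex.moduleCat_exact_iff_range_eq_ker]
  exact (congrArg (fun f ↦ LinearMap.range f.hom) (freeComplex_d Z (n + 1))).trans
    ((exact_freeD (freeArrow Z (n + 1)).hom).moduleCat_range_eq_ker.trans
      (congrArg (fun f ↦ LinearMap.ker f.hom) (freeComplex_d Z n)).symm)

lemma exists_freeComplex_X_eq (Z : ModuleCat.{u} R) (n : ℕ) :
    ∃ Y : ModuleCat.{u} R, (freeComplex Z).X n = Y.freeCover := by
  cases n with
  | zero => exact ⟨Z, rfl⟩
  | succ n => exact ⟨kernel (freeArrow Z n).hom, rfl⟩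

instance (Z : ModuleCat.{u} R) (n : ℕ) : Projective ((freeComplex Z).X n) := by
  obtain ⟨Y, h⟩ := exists_freeComplex_X_eq Z n
  rw [h]
  infer_instance

instance [IsNoetherianRing R] (Z : ModuleCat.{u} R) [Module.Finite R Z] (n : ℕ) :
    Module.Finite R (freeArrow Z n).left := by
  induction n with
  | zero => exact inferInstanceAs (Module.Finite R Z.freeCover)
  | succ n _ => exact inferInstanceAs (Module.Finite R (kernel (freeArrow Z n).hom).freeCover)

/-- A resolution of `Z` by free modules, of finite rank if `R` is Noetherian and `Z` is finitely
generated. -/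
noncomputable def freeResolution (Z : ModuleCat.{u} R) : ProjectiveResolution Z where
  complex := freeComplex Z
  π := (ChainComplex.toSingle₀Equiv _ _).symm ⟨Z.freeCoverπ,
    (congrArg (· ≫ Z.freeCoverπ) (freeComplex_d Z 0)).trans (freeD_comp Z.freeCoverπ)⟩
  quasiIso := ⟨fun n ↦ by
    cases n with
    | zero =>
      rw [ChainComplex.quasiIsoAt₀_iff, ShortComplex.quasiIso_iff_of_zeros' _ rfl rfl rfl,
        ShortComplex.moduleCat_exact_iff_range_eq_ker]
      exact ⟨(congrArg (fun f ↦ LinearMap.range f.hom) (freeComplex_d Z 0)).trans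
        (exact_freeD Z.freeCoverπ).moduleCat_range_eq_ker,
        inferInstanceAs (Epi Z.freeCoverπ)⟩
    | succ n =>
      rw [quasiIsoAt_iff_exactAt' _ _ (ChainComplex.exactAt_succ_single_obj _ _)]
      exact freeComplex_exactAt_succ Z n⟩

instance (Z : ModuleCat.{u} R) (n : ℕ) : Module.Free R (Z.freeResolution.complex.X n) := by
  obtain ⟨Y, h⟩ := exists_freeComplex_X_eq Z n
  change Module.Free R ((freeComplex Z).X n)
  rw [h]
  infer_instance

instance [IsNoetherianRing R] (Z : ModuleCat.{u} R) [Module.Finite R Z] (n : ℕ) :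
    Module.Finite R (Z.freeResolution.complex.X n) :=
  inferInstanceAs (Module.Finite R (freeArrow Z n).left)

end ModuleCat

end Resolution

/-! ### Homology of a quotient complex, read in the original complex. -/

section Reduction

variable {R : Type*} [CommRing R]

/-- If a complex `A' → B' → C'` is a quotient of `A → B → C`, then its homology is presented by
the elements of `B` mapping to zero in `C'`. -/
lemma exists_linearMap_comap_ker {A B C A' B' C' H : Type*} [AddCommGroup A] [Module R A]
    [AddCommGroup B] [Module R B] [AddCommGroup C] [Module R C] [AddCommGroup A'] [Module R A']
    [AddCommGroup B'] [Module R B'] [AddCommGroup C'] [Module R C'] [AddCommGroup H] [Module R H]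
    {f : A →ₗ[R] B} {g : B →ₗ[R] C} {f' : A' →ₗ[R] B'} {g' : B' →ₗ[R] C'}
    {a : A →ₗ[R] A'} {b : B →ₗ[R] B'} {c : C →ₗ[R] C'}
    (ha : Function.Surjective a) (hb : Function.Surjective b)
    (hf : f' ∘ₗ a = b ∘ₗ f) (hg : g' ∘ₗ b = c ∘ₗ g)
    (ψ : LinearMap.ker g' →ₗ[R] H) (hψ : Function.Surjective ψ)
    (hψ0 : ∀ z, ψ z = 0 ↔ (z : B') ∈ LinearMap.range f') :
    ∃ θ : (LinearMap.ker c).comap g →ₗ[R] H, Function.Surjective θ ∧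
      ∀ z, θ z = 0 ↔ (z : B) ∈ LinearMap.range f ⊔ LinearMap.ker b := by
  have hgb (z : B) : g' (b z) = c (g z) := LinearMap.congr_fun hg z
  have hr : ∀ z ∈ (LinearMap.ker c).comap g, b z ∈ LinearMap.ker g' := fun z hz ↦ by
    rw [LinearMap.mem_ker, hgb]
    exact hz
  refine ⟨ψ ∘ₗ b.restrict hr, hψ.comp ?_, fun z ↦ ?_⟩
  · rintro ⟨y, hy⟩
    obtain ⟨z, rfl⟩ := hb y
    rw [LinearMap.mem_ker, hgb] at hy
    exact ⟨⟨z, hy⟩, rfl⟩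
  -- Surjectivity of `a` makes the image of f' equal to b(im f), whose preimage under b is im f +
  -- ker b.
  · have h : LinearMap.range f' = (LinearMap.range f).map b := by
      rw [← LinearMap.range_comp, ← hf, LinearMap.range_comp, LinearMap.range_eq_top.2 ha,
        Submodule.map_top]
    rw [LinearMap.comp_apply, hψ0, h, ← Submodule.comap_map_eq]
    rfl

end Reduction

/-! ### The complex Hom(F, N/U). -/

section Hom

variable {R : Type*} [CommRing R] (F : Type*) [AddCommGroup F] [Module R F]
  {N : Type*} [AddCommGroup N] [Module R N]

/-- The linear maps from `F` with values in the submodule `U`. -/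
def Submodule.homInto (U : Submodule R N) : Submodule R (F →ₗ[R] N) where
  carrier := {φ | ∀ x, φ x ∈ U}
  add_mem' h h' x := add_mem (h x) (h' x)
  zero_mem' _ := zero_mem _
  smul_mem' c _ h x := U.smul_mem c (h x)

/-- Over a finite basis, φ is the sum of the maps x ↦ e_i*(x) φ(e_i), and each φ(e_i) lies in JU. -/
lemma Submodule.smul_homInto [Module.Free R F] [Module.Finite R F] (J : Ideal R)
    (U : Submodule R N) : J • U.homInto F = (J • U).homInto F := by
  refine le_antisymm (Submodule.smul_le.2 fun a ha φ hφ x ↦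
    Submodule.smul_mem_smul ha (hφ x)) fun φ hφ ↦ ?_
  let e := Module.Free.chooseBasis R F
  have h (i) : (J • U).map (LinearMap.smulRightₗ (M := N) (e.coord i)) ≤ J • U.homInto F := by
    rw [Submodule.map_smul'']
    refine Submodule.smul_mono le_rfl ?_
    rintro _ ⟨u, hu, rfl⟩ x
    exact U.smul_mem _ hu
  have hφ' : φ = ∑ i, LinearMap.smulRightₗ (M := N) (e.coord i) (φ (e i)) := by
    refine e.ext fun k ↦ ?_
    simp [Finsupp.single_apply]
  rw [hφ']
  exact sum_mem fun i _ ↦ h i ⟨_, hφ _, rfl⟩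

lemma Submodule.ker_compRight_mkQ (U : Submodule R N) :
    LinearMap.ker (LinearMap.compRight R U.mkQ : (F →ₗ[R] N) →ₗ[R] F →ₗ[R] N ⧸ U) =
      U.homInto F := by
  ext φ
  simp [LinearMap.ext_iff, Submodule.homInto]

end Hom

/-! ### The complex F ⊗ N/U. -/

section Tensor

open TensorProduct

variable {R : Type*} [CommRing R] (F : Type*) [AddCommGroup F] [Module R F]
  {N : Type*} [AddCommGroup N] [Module R N]

/-- The image of `F ⊗ U` in `F ⊗ N`. -/
def Submodule.tensorInto (U : Submodule R N) : Submodule R (F ⊗[R] N) :=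
  Submodule.map₂ (TensorProduct.mk R F N) ⊤ U

lemma Submodule.smul_tensorInto (J : Ideal R) (U : Submodule R N) :
    J • U.tensorInto F = (J • U).tensorInto F := by
  refine le_antisymm (Submodule.smul_le.2 fun a ha z hz ↦ ?_)
    (Submodule.map₂_le.2 fun x _ u hu ↦ ?_)
  · have h : U.tensorInto F ≤ ((J • U).tensorInto F).comap (LinearMap.lsmul R _ a) := by
      refine Submodule.map₂_le.2 fun x _ u hu ↦ ?_
      rw [Submodule.mem_comap, LinearMap.lsmul_apply, ← map_smul]
      exact Submodule.apply_mem_map₂ _ trivial (Submodule.smul_mem_smul ha hu)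
    exact h hz
  · have h : (J • U).map (TensorProduct.mk R F N x) ≤ J • U.tensorInto F := by
      rw [Submodule.map_smul'']
      refine Submodule.smul_mono le_rfl ?_
      rintro _ ⟨v, hv, rfl⟩
      exact Submodule.apply_mem_map₂ _ trivial hv
    exact h ⟨u, hu, rfl⟩

/-- Right exactness of the tensor product; no flatness of F enters. -/
lemma Submodule.ker_lTensor_mkQ (U : Submodule R N) :
    LinearMap.ker (U.mkQ.lTensor F) = U.tensorInto F := by
  rw [(lTensor_exact F (LinearMap.exact_subtype_mkQ U) U.mkQ_surjective).linearMap_ker_eq,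
    Submodule.tensorInto]
  refine le_antisymm ?_ (Submodule.map₂_le.2 fun x _ u hu ↦ ⟨x ⊗ₜ ⟨u, hu⟩, by simp⟩)
  rintro _ ⟨z, rfl⟩
  induction z with
  | zero => simp
  | add z z' hz hz' =>
    rw [map_add]
    exact add_mem hz hz'
  | tmul x u => exact Submodule.apply_mem_map₂ _ trivial u.2

end Tensor

/-! ### Ext and Tor as homology of explicit complexes of modules. -/

section Ext

variable {R : Type u} [CommRing R]

/-- Phrasing coboundaries through `next` covers degree 0 uniformly: there `next 0` is 0 and the
differential from 0 to itself is zero, so only f = 0 gives the zero class. -/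
lemma ProjectiveResolution.extMk_eq_zero_iff_next {C : Type*} [Category* C] [Abelian C]
    [HasExt C] {X Y : C} (P : ProjectiveResolution X) {n : ℕ} (f : P.complex.X n ⟶ Y)
    (hf : P.complex.d (n + 1) n ≫ f = 0) :
    P.extMk f (n + 1) rfl hf = 0 ↔ ∃ g : P.complex.X ((ComplexShape.down ℕ).next n) ⟶ Y,
      P.complex.d n ((ComplexShape.down ℕ).next n) ≫ g = f := by
  cases n with
  | succ n =>
    rw [P.extMk_eq_zero_iff f _ rfl hf n rfl]
    have h : (ComplexShape.down ℕ).next (n + 1) = n := by simp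
    rw [h]
  | zero =>
    rw [← P.extEquivCohomologyClass.apply_eq_iff_eq, P.extEquivCohomologyClass_extMk,
      P.extEquivCohomologyClass_zero, CochainComplex.HomComplex.CohomologyClass.mk_eq_zero_iff,
      CochainComplex.HomComplex.Cocycle.toSingleMk_mem_coboundaries_iff _ _ _ _ _ 1 (by simp)]
    have h1 : P.cochainComplex.d (-(0 : ℕ)) 1 = 0 :=
      (CochainComplex.isZero_of_isStrictlyLE _ 0 1 (by simp)).eq_of_tgt _ _
    rw [h1]
    have h2 : P.complex.d 0 ((ComplexShape.down ℕ).next 0) = 0 :=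
      P.complex.shape _ _ (by simp)
    rw [h2]
    refine ⟨fun ⟨_, h⟩ ↦ ⟨0, ?_⟩, fun ⟨_, h⟩ ↦ ⟨0, ?_⟩⟩
    · rw [Limits.zero_comp, eq_comm, Preadditive.IsIso.comp_left_eq_zero] at h
      rw [h, Limits.zero_comp]
    · rw [← h, Limits.zero_comp, Limits.zero_comp, Limits.comp_zero]

lemma exists_linearMap_ext (P : ModuleCat.{u} R) (Q : ProjectiveResolution P) (X : Type u)
    [AddCommGroup X] [Module R X] (i : ℕ) :
    ∃ ψ : LinearMap.ker (LinearMap.lcomp R X (Q.complex.d (i + 1) i).hom) →ₗ[R]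
        Abelian.Ext P (ModuleCat.of R X) i, Function.Surjective ψ ∧
      ∀ z, ψ z = 0 ↔ (z : Q.complex.X i →ₗ[R] X) ∈ LinearMap.range
        (LinearMap.lcomp R X (Q.complex.d i ((ComplexShape.down ℕ).next i)).hom) := by
  have hz (z : LinearMap.ker (LinearMap.lcomp R X (Q.complex.d (i + 1) i).hom)) :
      Q.complex.d (i + 1) i ≫ ModuleCat.ofHom (z : Q.complex.X i →ₗ[R] X) = 0 :=
    ModuleCat.hom_ext z.2
  refine ⟨{ toFun z := Q.extMk (ModuleCat.ofHom z) (i + 1) rfl (hz z)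
            map_add' z w := (Q.add_extMk _ _ _ rfl (hz z) (hz w)).symm
            map_smul' c z := ?_ }, fun α ↦ ?_, fun z ↦ ?_⟩
  · rw [RingHom.id_apply, Abelian.Ext.smul_eq_comp_mk₀, Q.extMk_comp_mk₀]
    rfl
  · obtain ⟨f, hf, rfl⟩ := Q.extMk_surjective α (i + 1) rfl
    exact ⟨⟨f.hom, ModuleCat.hom_ext_iff.1 hf⟩, rfl⟩
  · refine (ProjectiveResolution.extMk_eq_zero_iff_next Q _ (hz z)).trans ⟨?_, ?_⟩
    · rintro ⟨g, hg⟩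
      exact ⟨g.hom, ModuleCat.hom_ext_iff.1 hg⟩
    · rintro ⟨g, hg⟩
      exact ⟨ModuleCat.ofHom g, ModuleCat.hom_ext hg⟩

lemma exists_linearMap_homology (S : ShortComplex (ModuleCat.{u} R)) :
    ∃ ψ : LinearMap.ker S.g.hom →ₗ[R] S.homology, Function.Surjective ψ ∧
      ∀ z, ψ z = 0 ↔ (z : S.X₂) ∈ LinearMap.range S.f.hom := by
  let e : S.homology ≃ₗ[R] (LinearMap.ker S.g.hom ⧸ LinearMap.range S.moduleCatToCycles) :=
    S.moduleCatHomologyIso.toLinearEquiv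
  refine ⟨e.symm.toLinearMap ∘ₗ (LinearMap.range S.moduleCatToCycles).mkQ,
    e.symm.surjective.comp (Submodule.mkQ_surjective _), fun z ↦ ?_⟩
  rw [LinearMap.comp_apply, LinearEquiv.coe_coe, e.symm.map_eq_zero_iff, Submodule.mkQ_apply,
    Submodule.Quotient.mk_eq_zero]
  exact exists_congr fun _ ↦ Subtype.ext_iff

open MonoidalCategory TensorProduct in
lemma exists_linearMap_tor (P : ModuleCat.{u} R) (Q : ProjectiveResolution P) (X : Type u)
    [AddCommGroup X] [Module R X] (i : ℕ) :
    ∃ ψ : LinearMap.ker ((Q.complex.d i ((ComplexShape.down ℕ).next i)).hom.rTensor X) →ₗ[R]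
        ((Tor' (ModuleCat.{u} R) i).obj P).obj (ModuleCat.of R X), Function.Surjective ψ ∧
      ∀ z, ψ z = 0 ↔ (z : Q.complex.X i ⊗[R] X) ∈ LinearMap.range
        ((Q.complex.d ((ComplexShape.down ℕ).prev i) i).hom.rTensor X) := by
  let T := (tensoringRight (ModuleCat.{u} R)).obj (ModuleCat.of R X)
  let e := (Q.isoLeftDerivedObj T i).toLinearEquiv
  obtain ⟨ψ, hψ, hψ0⟩ := exists_linearMap_homology
    (((T.mapHomologicalComplex (ComplexShape.down ℕ)).obj Q.complex).sc i)
  exact ⟨e.symm.toLinearMap ∘ₗ ψ, e.symm.surjective.comp hψ,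
    fun z ↦ (e.symm.map_eq_zero_iff).trans (hψ0 z)⟩

end Ext

/-! ### The two stability statements and their combination. -/

section Main

variable {R : Type u} [CommRing R] [IsNoetherianRing R] {t : ℕ} (I : Fin t → Ideal R)
  (M N : Type u) [AddCommGroup M] [Module R M] [Module.Finite R M]
  [AddCommGroup N] [Module R N] [Module.Finite R N] (N' : Submodule R N) (i : ℕ)

theorem exists_forall_ge_associatedPrimes_extQuot_eq :
    ∃ k : Fin t →₀ ℕ, ∀ m ≥ k, ∀ n ≥ k,
      associatedPrimes R (extQuot I M N' i m) = associatedPrimes R (extQuot I M N' i n) := by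
  let Q := (ModuleCat.of R M).freeResolution
  refine exists_forall_ge_associatedPrimes_eq I
    (LinearMap.lcomp R N (Q.complex.d i ((ComplexShape.down ℕ).next i)).hom)
    (LinearMap.lcomp R N (Q.complex.d (i + 1) i).hom) ?_ (N'.homInto (Q.complex.X i))
    (N'.homInto (Q.complex.X (i + 1))) fun n ↦ ?_
  · ext φ x
    have h := ModuleCat.hom_ext_iff.1 (Q.complex.d_comp_d (i + 1) i ((ComplexShape.down ℕ).next i))
    exact (congrArg φ (LinearMap.congr_fun h x)).trans (map_zero φ)
  · rw [Submodule.smul_homInto, Submodule.smul_homInto, ← Submodule.ker_compRight_mkQ,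
      ← Submodule.ker_compRight_mkQ]
    obtain ⟨ψ, hψ, hψ0⟩ := exists_linearMap_ext (ModuleCat.of R M) Q (powQuot I N' n) i
    have hsurj (j : ℕ) : Function.Surjective
        (LinearMap.compRight R (multiPow I n • N').mkQ :
          (Q.complex.X j →ₗ[R] N) →ₗ[R] Q.complex.X j →ₗ[R] N ⧸ multiPow I n • N') :=
      -- Freeness of the terms of the resolution lets every map to the quotient of N lift to N.
      fun φ ↦ Module.projective_lifting_property _ φ (Submodule.mkQ_surjective _)
    exact exists_linearMap_comap_ker (hsurj _) (hsurj _) rfl rfl ψ hψ hψ0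

open TensorProduct in
theorem exists_forall_ge_associatedPrimes_torQuot_eq :
    ∃ k : Fin t →₀ ℕ, ∀ m ≥ k, ∀ n ≥ k,
      associatedPrimes R (torQuot I M N' i m) = associatedPrimes R (torQuot I M N' i n) := by
  let Q := (ModuleCat.of R M).freeResolution
  refine exists_forall_ge_associatedPrimes_eq I
    ((Q.complex.d ((ComplexShape.down ℕ).prev i) i).hom.rTensor N)
    ((Q.complex.d i ((ComplexShape.down ℕ).next i)).hom.rTensor N) ?_
    (N'.tensorInto (Q.complex.X i))
    (N'.tensorInto (Q.complex.X ((ComplexShape.down ℕ).next i))) fun n ↦ ?_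
  · rw [← LinearMap.rTensor_comp, ← ModuleCat.hom_comp, HomologicalComplex.d_comp_d,
      ModuleCat.hom_zero, LinearMap.rTensor_zero]
  · rw [Submodule.smul_tensorInto, Submodule.smul_tensorInto, ← Submodule.ker_lTensor_mkQ,
      ← Submodule.ker_lTensor_mkQ]
    obtain ⟨ψ, hψ, hψ0⟩ := exists_linearMap_tor (ModuleCat.of R M) Q (powQuot I N' n) i
    have hsurj (j : ℕ) : Function.Surjective
        ((multiPow I n • N').mkQ.lTensor (Q.complex.X j)) :=
      LinearMap.lTensor_surjective _ (Submodule.mkQ_surjective _)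
    refine exists_linearMap_comap_ker (hsurj _) (hsurj _) ?_ ?_ ψ hψ hψ0
    · exact (LinearMap.rTensor_comp_lTensor ..).trans (LinearMap.lTensor_comp_rTensor ..).symm
    · exact (LinearMap.rTensor_comp_lTensor ..).trans (LinearMap.lTensor_comp_rTensor ..).symm

end Main

theorem mainTheorem1 {R : Type u} [CommRing R] [IsNoetherianRing R]
    {t : ℕ} (I : Fin t → Ideal R)
    (M N : Type u) [AddCommGroup M] [Module R M] [Module.Finite R M]
    [AddCommGroup N] [Module R N] [Module.Finite R N]
    (N' : Submodule R N) (i : ℕ) :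
    ∃ k : Fin t → ℕ, ∀ m ≥ k, ∀ n ≥ k,
      associatedPrimes R (extQuot I M N' i m) = associatedPrimes R (extQuot I M N' i n) ∧
      associatedPrimes R (torQuot I M N' i m) = associatedPrimes R (torQuot I M N' i n) := by
  obtain ⟨k₁, h₁⟩ := exists_forall_ge_associatedPrimes_extQuot_eq I M N N' i
  obtain ⟨k₂, h₂⟩ := exists_forall_ge_associatedPrimes_torQuot_eq I M N N' i
  refine ⟨⇑(k₁ ⊔ k₂), fun m hm n hn ↦ ?_⟩
  obtain ⟨m, rfl⟩ := Finsupp.equivFunOnFinite.surjective m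
  obtain ⟨n, rfl⟩ := Finsupp.equivFunOnFinite.surjective n
  have hm' : k₁ ⊔ k₂ ≤ m := hm
  have hn' : k₁ ⊔ k₂ ≤ n := hn
  exact ⟨h₁ m (le_sup_left.trans hm') n (le_sup_left.trans hn'),
    h₂ m (le_sup_right.trans hm') n (le_sup_right.trans hn')⟩
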